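/- Fix a constant $c_0>0$ and call a real random variable $z$ centred sub-Gaussian with parameter $\sigma>0$ if $\mathbb{E}z=0$ and $\mathbb{E}e^{tz}\le \exp\!\big(\sigma^2t^2/(2c_0)\big)$ for all $t\in\mathbb{R}$. Let $R_m\subseteq\{1,\dots,m\}$ and $C_n\subseteq\{1,\dots,n\}$ with $|R_m|=k_m\ge 1$ and $|C_n|=k_n\ge 1$, and let $$X=\lambda\,1_{R_m}1_{C_n}^T+Z\in\mathbb{R}^{m\times n},$$ where the entries of $Z$ are i.i.d. centred sub-Gaussian random variables with parameter $\sigma$. The vanilla spectral projection algorithm takes the single matrix $X$ as input and proceeds as follows. 1. Compute a pair of top left and right singular vectors $u\in\mathbb{R}^m$, $v\in\mathbb{R}^n$ of $X$, that is, Euclidean unit vectors with $Xv=\|X\|_2u$ and $X^Tu=\|X\|_2v$, where $\|X\|_2$ is the spectral norm. 2. Compute the projections $a_i=X_{i\cdot}v$ $(1\le i\le m)$ and $b_j=u^TX_{\cdot j}$ $(1\le j\le n)$ of the rows and columns, and threshold them at half of their maximal modulus: $$\hat R_m=\big\{i:\ |a_i|\ge\tfrac12\max_{l}|a_l|\big\},\qquad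 \hat C_n=\big\{j:\ |b_j|\ge\tfrac12\max_{l}|b_l|\big\}.$$ There exist constants $C>0$ and $c>0$, depending only on $c_0$, such that, for all $m,n,k_m,k_n,R_m,C_n,\lambda,\sigma$ as above (in particular in the dense regime $\min\{k_m,k_n\}\succsim\max\{m^{1/2},n^{1/2}\}$), if $$\frac{\lambda}{\sigma}\ \ge\ C\left(\sqrt{\frac{m\vee n}{k_mk_n}}+\sqrt{\frac{\log n}{k_m}\vee\frac{\log m}{k_n}}\right),$$ then with probability at least $1-m^{-c}-n^{-c}-2\exp(-c(m+n))$ the algorithm recovers the submatrix exactly: $\hat R_m=R_m$ and $\hat C_n=C_n$ for every admissible choice of the top singular pair. -/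

import Mathlib

open MeasureTheory ProbabilityTheory
open scoped Matrix

namespace SubmatrixLocalization

/-- The indicator vector of a finite index set: `1` on the set and `0` elsewhere. -/
def indicatorVec {p : ℕ} (S : Finset (Fin p)) : Fin p → ℝ :=
  fun i => if i ∈ S then 1 else 0

/-- The mean matrix `lam • 1_R 1_Cᵀ`. -/
def signal {m n : ℕ} (lam : ℝ) (R : Finset (Fin m)) (C : Finset (Fin n)) :
    Matrix (Fin m) (Fin n) ℝ :=
  lam • Matrix.vecMulVec (indicatorVec R) (indicatorVec C)

/-- The entries of the random matrix `Z` are i.i.d., centred and sub-Gaussian with parameter `σ`: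
`𝔼 exp (t * Z i j) ≤ exp (σ ^ 2 * t ^ 2 / (2 * c₀))` for all real `t`, where `c₀` is the fixed
constant in the definition of sub-Gaussianity. -/
structure IsSubGaussianNoise {Ω : Type*} [MeasurableSpace Ω] (μ : Measure Ω) {m n : ℕ}
    (c₀ σ : ℝ) (Z : Ω → Matrix (Fin m) (Fin n) ℝ) : Prop where
  aemeasurable : ∀ i j, AEMeasurable (fun ω => Z ω i j) μ
  indep : iIndepFun (fun (p : Fin m × Fin n) ω => Z ω p.1 p.2) μ
  identDistrib : ∀ i j i' j', IdentDistrib (fun ω => Z ω i j) (fun ω => Z ω i' j') μ μ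
  mean_zero : ∀ i j, ∫ ω, Z ω i j ∂μ = 0
  subGaussian : ∀ i j, HasSubgaussianMGF (fun ω => Z ω i j) (σ ^ 2 / c₀).toNNReal μ

open scoped Matrix.Norms.L2Operator in
/-- `u` and `v` are a pair of top left and right singular vectors of `X`: Euclidean unit vectors
with `X v = s u` and `Xᵀ u = s v`, where `s = ‖X‖` is the largest singular value of `X`, that is,
its norm as an operator between Euclidean spaces. -/
def IsTopSingularPair {m n : ℕ} (X : Matrix (Fin m) (Fin n) ℝ)
    (u : Fin m → ℝ) (v : Fin n → ℝ) : Prop :=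
  u ⬝ᵥ u = 1 ∧ v ⬝ᵥ v = 1 ∧ X *ᵥ v = ‖X‖ • u ∧ Xᵀ *ᵥ u = ‖X‖ • v

open scoped Classical in
/-- The cut-off at half of the maximum: the indices `i` with `|d i| ≥ (max over l of |d l|) / 2`.
It uses nothing but the scores `d`. -/
noncomputable def threshold {p : ℕ} (d : Fin p → ℝ) : Finset (Fin p) :=
  Finset.univ.filter fun i => ∀ l, |d l| / 2 ≤ |d i|

/-- Projection and thresholding, from a pair `u`, `v` of left and right vectors: the estimated row
set is obtained from the scores `X i · v` of the rows, and the estimated column set from the scores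
`u · X j` of the columns. -/
noncomputable def projectAndThreshold {m n : ℕ} (X : Matrix (Fin m) (Fin n) ℝ)
    (u : Fin m → ℝ) (v : Fin n → ℝ) : Finset (Fin m) × Finset (Fin n) :=
  (threshold fun i => (fun j => X i j) ⬝ᵥ v, threshold fun j => u ⬝ᵥ fun i => X i j)

/-- All possible outputs of the vanilla spectral projection algorithm on the data matrix `X`.
Singular vectors are determined at best up to a sign, and the set ranges over all admissible
choices of the top pair. -/
def spectralOutputs {m n : ℕ} (X : Matrix (Fin m) (Fin n) ℝ) :
    Set (Finset (Fin m) × Finset (Fin n)) :=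
  {out | ∃ u v, IsTopSingularPair X u v ∧ out = projectAndThreshold X u v}

end SubmatrixLocalization

/-! The mean `S` has rank one, with singular value `θ = lam * √km * √kn` and unit singular vectors
`p`, `q` along the indicators of the rows and columns. The row scores are `θ ⟪q, v⟫ p i + ⟪z i, v⟫`,
with `z i` the `i`-th noise row. If the noise has norm at most `θ / 40`, then `|⟪q, v⟫| ≥ 19 / 20`,
so the signal part is nearly `lam * √kn` in modulus on `R` and zero off `R`. Exact recovery of `R`
follows once every `|⟪z i, v⟫|` is at most a twentieth of that.

Cauchy–Schwarz only gives `‖z i‖ ≤ θ / 40`, too large by a factor of order `√km`, and `v` depends on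
`z i`. The remedy is leave-one-out. Let `v'` be the top right singular vector after the noise in row
`i` is erased. It is independent of `z i`, so `⟪z i, v'⟫` has a sub-Gaussian tail, and a union bound
covers all rows. A sine theorem using only the action of the erased row on the pair `u'`, `v'`
brings `v` within order `1 / √km` of the line of `v'`; the bound then passes to `v`
(`IsTopPair.abs_inner_le_of_leave_one_out`).

The norm bound comes from nets, and columns are rows of the transpose. Compactness of spheres makes
the event over all top pairs measurable without selecting one. -/

section TopPair

/-! ### Singular vectors of perturbed rank-one operators. -/

open scoped RealInnerProductSpace

variable {E F : Type*} [NormedAddCommGroup E] [InnerProductSpace ℝ E]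
  [NormedAddCommGroup F] [InnerProductSpace ℝ F]

/-- `u` and `v` are top left and right singular vectors of the bounded operator `X`. -/
structure IsTopPair (X : E →L[ℝ] F) (u : F) (v : E) : Prop where
  norm_left : ‖u‖ = 1
  norm_right : ‖v‖ = 1
  map_right : X v = ‖X‖ • u
  inner_left : ∀ y, ⟪u, X y⟫ = ‖X‖ * ⟪v, y⟫

/-- A nonzero operator on a finite-dimensional space has a top singular pair. -/
theorem exists_isTopPair [FiniteDimensional ℝ E] (X : E →L[ℝ] F) (hX : X ≠ 0) :
    ∃ u v, IsTopPair X u v := by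
  have hs : 0 < ‖X‖ := norm_pos_iff.2 hX
  obtain ⟨y, hy⟩ : ∃ y, X y ≠ 0 := by
    by_contra! h
    exact hX (ContinuousLinearMap.ext h)
  have hy0 : y ≠ 0 := by
    rintro rfl
    simp at hy
  have hne : (Metric.sphere (0 : E) 1).Nonempty :=
    ⟨(‖y‖⁻¹) • y, by simp [norm_smul, hy0]⟩
  obtain ⟨v, hv, hmax⟩ := (isCompact_sphere (0 : E) 1).exists_isMaxOn hne
    (f := fun x => ‖X x‖) (by fun_prop)
  have hv1 : ‖v‖ = 1 := by simpa using hv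
  have hXv : ‖X v‖ = ‖X‖ := by
    apply le_antisymm
    · simpa [hv1] using X.le_opNorm v
    · exact ContinuousLinearMap.opNorm_le_of_unit_norm (norm_nonneg _)
        fun x hx => hmax (by simpa using hx)
  refine ⟨‖X‖⁻¹ • X v, v, ?_, hv1, ?_, ?_⟩
  · rw [norm_smul, hXv, norm_inv, norm_norm, inv_mul_cancel₀ hs.ne']
  · rw [smul_smul, mul_inv_cancel₀ hs.ne', one_smul]
  · -- the maximality of `v` makes the derivative of `‖X (v + t y)‖² - ‖X‖² ‖v + t y‖²` vanish
    intro y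
    have key : ∀ t : ℝ, 0 ≤ (‖X‖ ^ 2 * ‖y‖ ^ 2 - ‖X y‖ ^ 2) * (t * t) +
        (2 * (‖X‖ ^ 2 * ⟪v, y⟫ - ⟪X v, X y⟫)) * t + 0 := by
      intro t
      have h1 : ‖X (v + t • y)‖ ^ 2 ≤ (‖X‖ * ‖v + t • y‖) ^ 2 := by
        gcongr
        exact X.le_opNorm _
      rw [mul_pow, map_add, map_smul, norm_add_sq_real, norm_add_sq_real, norm_smul, norm_smul,
        inner_smul_right, inner_smul_right, mul_pow, mul_pow, hXv, hv1, Real.norm_eq_abs,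
        sq_abs] at h1
      linarith
    -- The constant term is zero, so the discriminant is the square of the linear coefficient.
    have hd := discrim_le_zero key
    have h0 : ⟪X v, X y⟫ = ‖X‖ ^ 2 * ⟪v, y⟫ := by
      unfold discrim at hd
      nlinarith [sq_nonneg (‖X‖ ^ 2 * ⟪v, y⟫ - ⟪X v, X y⟫)]
    rw [real_inner_smul_left, h0]
    field_simp

variable {S X A : E →L[ℝ] F} {p u u' : F} {q v v' : E} {θ η : ℝ}

theorem sub_le_opNorm_of_rank_one (hp : ‖p‖ = 1) (hq : ‖q‖ = 1)
    (hS : ∀ y, S y = (θ * ⟪q, y⟫) • p) (hθ : 0 ≤ θ) (hX : ‖X - S‖ ≤ η) :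
    θ - η ≤ ‖X‖ := by
  have h1 : ‖S q‖ = θ := by
    rw [hS, norm_smul, hp, real_inner_self_eq_norm_sq, hq]
    simp [abs_of_nonneg hθ]
  have h2 : ‖S q‖ ≤ ‖S‖ := by simpa [hq] using S.le_opNorm q
  have h3 : ‖S‖ ≤ ‖X‖ + ‖X - S‖ := by
    simpa using norm_sub_le X (X - S)
  linarith

/-- The top singular vectors of a small perturbation of a rank-one operator are close to those of
the rank-one operator. -/
theorem IsTopPair.abs_inner_ge (h : IsTopPair X u v) (hp : ‖p‖ = 1) (hq : ‖q‖ = 1)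
    (hS : ∀ y, S y = (θ * ⟪q, y⟫) • p) (hθ : 0 < θ) (hX : ‖X - S‖ ≤ η) (hη : 40 * η ≤ θ) :
    19 / 20 ≤ |⟪q, v⟫| ∧ 19 / 20 ≤ |⟪u, p⟫| := by
  have hs := sub_le_opNorm_of_rank_one hp hq hS hθ.le hX
  have h1 : ⟪u, X v⟫ = ‖X‖ := by
    rw [h.inner_left, real_inner_self_eq_norm_sq, h.norm_right]; simp
  have h2 : ⟪u, X v⟫ = θ * (⟪q, v⟫ * ⟪u, p⟫) + ⟪u, (X - S) v⟫ := by
    have : X v = S v + (X - S) v := by simp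
    rw [this, inner_add_right, hS, inner_smul_right]; ring
  have h3 : ⟪u, (X - S) v⟫ ≤ η := by
    refine (real_inner_le_norm _ _).trans ?_
    rw [h.norm_left, one_mul]
    exact ((X - S).le_opNorm v).trans (by rw [h.norm_right, mul_one]; exact hX)
  -- From `θ - η ≤ ‖X‖ ≤ θ * (⟪q, v⟫ * ⟪u, p⟫) + η`, the product is at least `1 - 2 / 40`.
  have h4 : 19 / 20 ≤ ⟪q, v⟫ * ⟪u, p⟫ := by
    by_contra! hc
    nlinarith
  have hqv : |⟪q, v⟫| ≤ 1 := by
    simpa [hq, h.norm_right] using abs_real_inner_le_norm q v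
  have hup : |⟪u, p⟫| ≤ 1 := by
    simpa [hp, h.norm_left] using abs_real_inner_le_norm u p
  have h5 : 19 / 20 ≤ |⟪q, v⟫| * |⟪u, p⟫| := by
    rw [← abs_mul]; exact h4.trans (le_abs_self _)
  constructor <;> nlinarith [abs_nonneg ⟪q, v⟫, abs_nonneg ⟪u, p⟫]

/-- The second singular value is at most `3 η`. -/
theorem IsTopPair.norm_map_le_of_inner_eq_zero (h : IsTopPair X u v) (hp : ‖p‖ = 1) (hq : ‖q‖ = 1)
    (hS : ∀ y, S y = (θ * ⟪q, y⟫) • p) (hθ : 0 < θ) (hX : ‖X - S‖ ≤ η) (hη : 40 * η ≤ θ)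
    {x : E} (hx : ⟪v, x⟫ = 0) : ‖X x‖ ≤ 3 * η * ‖x‖ := by
  have hup := (h.abs_inner_ge hp hq hS hθ hX hη).2
  have hdec : X x = S x + (X - S) x := by simp
  have hW : ‖(X - S) x‖ ≤ η * ‖x‖ := ((X - S).le_opNorm x).trans (by gcongr)
  -- As `⟪u, X x⟫ = ‖X‖ * ⟪v, x⟫ = 0`, signal and noise cancel along `u`; since `u` nearly aligns
  -- with `p`, this controls all of `S x`.
  have h0 : θ * ⟪q, x⟫ * ⟪u, p⟫ = -⟪u, (X - S) x⟫ := by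
    have h1 := h.inner_left x
    rw [hx, mul_zero, hdec, inner_add_right, hS, inner_smul_right] at h1
    linarith
  have h1 : |θ * ⟪q, x⟫| * |⟪u, p⟫| ≤ η * ‖x‖ := by
    rw [← abs_mul, h0, abs_neg]
    refine (abs_real_inner_le_norm _ _).trans ?_
    rw [h.norm_left, one_mul]
    exact hW
  have h2 : ‖S x‖ ≤ 2 * (η * ‖x‖) := by
    rw [hS, norm_smul, hp, mul_one, Real.norm_eq_abs]
    nlinarith [abs_nonneg (θ * ⟪q, x⟫)]
  calc ‖X x‖ ≤ ‖S x‖ + ‖(X - S) x‖ := by rw [hdec]; exact norm_add_le _ _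
    _ ≤ 3 * η * ‖x‖ := by linarith

/-- A sine theorem: the right top singular vectors of two small perturbations of the same rank-one
operator differ by little if the difference of the two is small at the top pair of one of them. -/
theorem IsTopPair.norm_sub_proj_le (h : IsTopPair X u v) (h' : IsTopPair A u' v')
    (hp : ‖p‖ = 1) (hq : ‖q‖ = 1)
    (hS : ∀ y, S y = (θ * ⟪q, y⟫) • p) (hθ : 0 < θ) (hX : ‖X - S‖ ≤ η) (hA : ‖A - S‖ ≤ η)
    (hη : 40 * η ≤ θ) {r₁ r₂ : ℝ} (h₁ : ‖(X - A) v'‖ ≤ r₁)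
    (h₂ : ∀ y, |⟪u', (X - A) y⟫| ≤ r₂ * ‖y‖) :
    9 / 10 * θ * ‖v' - ⟪v, v'⟫ • v‖ ≤ r₁ + r₂ := by
  set x := v' - ⟪v, v'⟫ • v with hxdef
  set y := u' - ⟪u, u'⟫ • u with hydef
  have hη0 : 0 ≤ η := (norm_nonneg _).trans hX
  have hvx : ⟪v, x⟫ = 0 := by
    rw [hxdef, inner_sub_right, inner_smul_right, real_inner_self_eq_norm_sq, h.norm_right]; ring
  have huy : ⟪u, y⟫ = 0 := by
    rw [hydef, inner_sub_right, inner_smul_right, real_inner_self_eq_norm_sq, h.norm_left]; ring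
  have hv' : v' = x + ⟪v, v'⟫ • v := by rw [hxdef]; abel
  have hu' : u' = y + ⟪u, u'⟫ • u := by rw [hydef]; abel
  have hs := sub_le_opNorm_of_rank_one hp hq hS hθ.le hA
  have hXx := h.norm_map_le_of_inner_eq_zero hp hq hS hθ hX hη hvx
  have hcross : ⟪y, X x⟫ ≤ 3 * η * ‖x‖ * ‖y‖ := by
    refine (real_inner_le_norm _ _).trans ?_
    rw [mul_comm]
    gcongr
  have hyy : ⟪y, u'⟫ = ‖y‖ ^ 2 := by
    nth_rewrite 1 [hu']
    rw [inner_add_right, inner_smul_right, real_inner_comm u y, huy, real_inner_self_eq_norm_sq]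
    ring
  have hxx : ⟪v', x⟫ = ‖x‖ ^ 2 := by
    nth_rewrite 1 [hv']
    rw [inner_add_left, real_inner_smul_left, hvx, real_inner_self_eq_norm_sq]
    ring
  -- Evaluate `⟪y, (X - A) v'⟫`: `A` contributes `‖A‖ * ‖y‖ ^ 2`, while `X` sees only `x`, because
  -- `y` is orthogonal to `u`. The bound `e2` is the mirror image.
  have e1 : ‖A‖ * ‖y‖ ^ 2 ≤ 3 * η * ‖x‖ * ‖y‖ + r₁ * ‖y‖ := by
    have a1 : ⟪y, A v'⟫ = ‖A‖ * ‖y‖ ^ 2 := by rw [h'.map_right, inner_smul_right, hyy]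
    have a2 : ⟪y, X v'⟫ = ⟪y, X x⟫ := by
      nth_rewrite 1 [hv']
      rw [map_add, map_smul, h.map_right, inner_add_right, inner_smul_right, inner_smul_right,
        real_inner_comm u y, huy]
      ring
    have a3 : ⟪y, (X - A) v'⟫ = ⟪y, X v'⟫ - ⟪y, A v'⟫ := by
      rw [sub_apply, inner_sub_right]
    have a4 : |⟪y, (X - A) v'⟫| ≤ r₁ * ‖y‖ := by
      refine (abs_real_inner_le_norm _ _).trans ?_
      rw [mul_comm]; gcongr
    have := (abs_le.1 a4).1
    linarith
  have e2 : ‖A‖ * ‖x‖ ^ 2 ≤ 3 * η * ‖x‖ * ‖y‖ + r₂ * ‖x‖ := by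
    have a1 : ⟪u', A x⟫ = ‖A‖ * ‖x‖ ^ 2 := by rw [h'.inner_left, hxx]
    have a2 : ⟪u', X x⟫ = ⟪y, X x⟫ := by
      nth_rewrite 1 [hu']
      rw [inner_add_left, real_inner_smul_left, h.inner_left, hvx]
      ring
    have a3 : ⟪u', (X - A) x⟫ = ⟪u', X x⟫ - ⟪u', A x⟫ := by
      rw [sub_apply, inner_sub_right]
    have := (abs_le.1 (h₂ x)).1
    linarith
  have hr1 : 0 ≤ r₁ := (norm_nonneg _).trans h₁
  have hr2 : 0 ≤ r₂ := by
    have := (abs_nonneg _).trans (h₂ v')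
    rwa [h'.norm_right, mul_one] at this
  have f1 : ‖A‖ * ‖y‖ ≤ 3 * η * ‖x‖ + r₁ := by
    rcases (norm_nonneg y).eq_or_lt with hy | hy
    · rw [← hy, mul_zero]; positivity
    · refine le_of_mul_le_mul_right ?_ hy; linarith
  have f2 : ‖A‖ * ‖x‖ ≤ 3 * η * ‖y‖ + r₂ := by
    rcases (norm_nonneg x).eq_or_lt with hy | hy
    · rw [← hy, mul_zero]; positivity
    · refine le_of_mul_le_mul_right ?_ hy; linarith
  -- The spectral gap is at least `θ - 4 * η`; adding `f1` and `f2` bounds it times `‖x‖ + ‖y‖` by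
  -- `r₁ + r₂`.
  have g : 9 / 10 * θ ≤ ‖A‖ - 3 * η := by linarith
  nlinarith [mul_le_mul_of_nonneg_right g (norm_nonneg x),
    mul_le_mul_of_nonneg_right g (norm_nonneg y), mul_nonneg hθ.le (norm_nonneg y)]

theorem inner_sq_add_norm_sub_proj_sq (hv : ‖v‖ = 1) (hv' : ‖v'‖ = 1) :
    ⟪v, v'⟫ ^ 2 + ‖v' - ⟪v, v'⟫ • v‖ ^ 2 = 1 := by
  rw [norm_sub_sq_real, inner_smul_right, norm_smul, hv, hv', real_inner_comm, Real.norm_eq_abs,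
    mul_one, sq_abs]
  ring

/-- The right top singular vector of a small perturbation of a rank-one operator is unique up to
sign. -/
theorem IsTopPair.right_unique (h : IsTopPair X u v) (h' : IsTopPair X u' v')
    (hp : ‖p‖ = 1) (hq : ‖q‖ = 1) (hS : ∀ y, S y = (θ * ⟪q, y⟫) • p) (hθ : 0 < θ)
    (hX : ‖X - S‖ ≤ η) (hη : 40 * η ≤ θ) : v' = v ∨ v' = -v := by
  -- The sine theorem with both operators equal has zero residuals.
  have h0 := h.norm_sub_proj_le h' hp hq hS hθ hX hX hη (r₁ := 0) (r₂ := 0) (by simp) (by simp)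
  have h1 : ‖v' - ⟪v, v'⟫ • v‖ = 0 := by
    nlinarith [norm_nonneg (v' - ⟪v, v'⟫ • v)]
  have h2 := inner_sq_add_norm_sub_proj_sq h.norm_right h'.norm_right
  have h3 : ⟪v, v'⟫ ^ 2 = 1 := by rw [h1] at h2; linarith
  have h4 : v' = ⟪v, v'⟫ • v := sub_eq_zero.1 (norm_eq_zero.1 h1)
  rcases mul_self_eq_one_iff.1 ((sq _).symm.trans h3) with h5 | h5
  · left; rw [h5, one_smul] at h4; exact h4
  · right; rw [h5, neg_one_smul] at h4; exact h4

/-- The leave-one-out step: the noise `z` of one row, left out in `A`, has a small product with the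
top right singular vector of `X` if it has one with that of `A`. -/
theorem IsTopPair.abs_inner_le_of_leave_one_out (h : IsTopPair X u v) (h' : IsTopPair A u' v')
    (hp : ‖p‖ = 1) (hq : ‖q‖ = 1)
    (hS : ∀ y, S y = (θ * ⟪q, y⟫) • p) (hθ : 0 < θ) (hX : ‖X - S‖ ≤ η) (hA : ‖A - S‖ ≤ η)
    (hη : 40 * η ≤ θ) {e : F} {z : E} {ρ : ℝ} (he : ‖e‖ = 1)
    (hXA : ∀ y, (X - A) y = ⟪z, y⟫ • e) (hAe : ∀ y, ⟪e, A y⟫ = ⟪e, S y⟫)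
    (hz : ‖z‖ ≤ η) (hep : |⟪e, p⟫| ≤ ρ) (hρ : ρ ≤ 1) (hzv : |⟪z, v'⟫| ≤ η * ρ) :
    |⟪z, v⟫| ≤ 2 * (η * ρ) := by
  have hη0 : 0 ≤ η := (norm_nonneg _).trans hX
  have hρ0 : 0 ≤ ρ := (abs_nonneg _).trans hep
  have hs := sub_le_opNorm_of_rank_one hp hq hS hθ.le hA
  have hqv : |⟪q, v'⟫| ≤ 1 := by
    simpa [hq, h'.norm_right] using abs_real_inner_le_norm q v'
  -- The component of `A` along `e` is noise-free, so `‖A‖ * ⟪u', e⟫` is a pure signal term, and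
  -- `‖A‖ ≥ 39 / 40 * θ`.
  have hue : |⟪u', e⟫| ≤ 11 / 10 * ρ := by
    have h1 : ‖A‖ * ⟪u', e⟫ = θ * ⟪q, v'⟫ * ⟪e, p⟫ := by
      have := hAe v'
      rw [h'.map_right, hS, inner_smul_right, inner_smul_right, real_inner_comm] at this
      exact this
    have h2 : ‖A‖ * |⟪u', e⟫| ≤ θ * ρ := by
      rw [← abs_of_nonneg (norm_nonneg A), ← abs_mul, h1, abs_mul, abs_mul, abs_of_pos hθ]
      have : |⟪q, v'⟫| * |⟪e, p⟫| ≤ 1 * ρ := by gcongr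
      nlinarith
    have h3 : 39 / 40 * θ * |⟪u', e⟫| ≤ θ * ρ :=
      le_trans (by gcongr; linarith) h2
    have h4 : θ * (39 / 40 * |⟪u', e⟫|) ≤ θ * ρ := by linarith
    have h5 := le_of_mul_le_mul_left h4 hθ
    linarith
  have hperp := h.norm_sub_proj_le h' hp hq hS hθ hX hA hη (r₁ := η * ρ)
    (r₂ := η * (11 / 10 * ρ)) (by rw [hXA, norm_smul, he, mul_one]; exact hzv) (by
      intro y
      rw [hXA, inner_smul_right, abs_mul, mul_right_comm]
      gcongr
      exact (abs_real_inner_le_norm _ _).trans (by gcongr))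
  set x := v' - ⟪v, v'⟫ • v with hxdef
  -- The residuals total `21 / 10 * (η * ρ) ≤ 21 / 400 * (θ * ρ)`.
  have hx : ‖x‖ ≤ ρ / 10 := by
    have : θ * (9 / 10 * ‖x‖) ≤ θ * (21 / 400 * ρ) := by nlinarith
    have := le_of_mul_le_mul_left this hθ
    linarith
  have hα : 9 / 10 ≤ |⟪v, v'⟫| := by
    have h2 := inner_sq_add_norm_sub_proj_sq h.norm_right h'.norm_right
    rw [← hxdef, ← sq_abs ⟪v, v'⟫] at h2
    have : ‖x‖ ^ 2 ≤ (1 / 10) ^ 2 := by gcongr; linarith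
    nlinarith [abs_nonneg ⟪v, v'⟫]
  have hdec : ⟪v, v'⟫ * ⟪z, v⟫ = ⟪z, v'⟫ - ⟪z, x⟫ := by
    rw [hxdef, inner_sub_right, inner_smul_right]; ring
  have hzx : |⟪z, x⟫| ≤ η * (ρ / 10) := (abs_real_inner_le_norm _ _).trans (by gcongr)
  have hfin : |⟪v, v'⟫| * |⟪z, v⟫| ≤ η * ρ + η * (ρ / 10) := by
    rw [← abs_mul, hdec]
    exact (abs_sub _ _).trans (by linarith)
  nlinarith [abs_nonneg ⟪z, v⟫, mul_nonneg hη0 hρ0]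

end TopPair

/-! ### Nets and the operator norm. -/

section Net

open scoped RealInnerProductSpace

/-- The unit ball of a `d`-dimensional normed space has a `1/2`-net of at most `5 ^ d` points. -/
theorem exists_half_net (E : Type*) [NormedAddCommGroup E] [NormedSpace ℝ E]
    [FiniteDimensional ℝ E] :
    ∃ s : Finset E, (∀ x ∈ s, ‖x‖ ≤ 1) ∧ s.card ≤ 5 ^ Module.finrank ℝ E ∧
      ∀ x : E, ‖x‖ ≤ 1 → ∃ y ∈ s, ‖x - y‖ ≤ 1 / 2 := by
  classical
  -- A largest `1`-separated set in the ball of radius `2` is halved to give the net; a point left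
  -- uncovered would enlarge it.
  let P : ℕ → Prop := fun k => ∃ t : Finset E, t.card = k ∧ (∀ c ∈ t, ‖c‖ ≤ 2) ∧
    ∀ c ∈ t, ∀ d ∈ t, c ≠ d → 1 ≤ ‖c - d‖
  have hbound : ∀ k, P k → k ≤ 5 ^ Module.finrank ℝ E := by
    rintro k ⟨t, rfl, h1, h2⟩
    exact Besicovitch.card_le_of_separated t h1 h2
  have hP0 : P 0 := ⟨∅, by simp, by simp, by simp⟩
  obtain ⟨t, htc, ht1, ht2⟩ : P (Nat.findGreatest P (5 ^ Module.finrank ℝ E)) :=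
    Nat.findGreatest_spec (Nat.zero_le _) hP0
  refine ⟨t.image fun c => (1 / 2 : ℝ) • c, ?_, ?_, ?_⟩
  · intro x hx
    obtain ⟨c, hc, rfl⟩ := Finset.mem_image.1 hx
    rw [norm_smul, Real.norm_eq_abs, abs_of_pos (by norm_num)]
    linarith [ht1 c hc]
  · exact Finset.card_image_le.trans (htc ▸ Nat.findGreatest_le _)
  · intro x hx
    by_contra! hcon
    have hsep : ∀ c ∈ t, 1 < ‖(2 : ℝ) • x - c‖ := by
      intro c hc
      have h1 := hcon _ (Finset.mem_image_of_mem _ hc)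
      have h2 : (2 : ℝ) • x - c = (2 : ℝ) • (x - (1 / 2 : ℝ) • c) := by
        rw [smul_sub, smul_smul]; norm_num
      rw [h2, norm_smul, Real.norm_eq_abs, abs_of_pos (by norm_num)]
      linarith
    have hnot : (2 : ℝ) • x ∉ t := fun hmem => by
      have := hsep _ hmem
      simp at this
      linarith
    have hbig : P (t.card + 1) := by
      refine ⟨insert ((2 : ℝ) • x) t, Finset.card_insert_of_notMem hnot, ?_, ?_⟩
      · intro c hc
        rcases Finset.mem_insert.1 hc with rfl | hc
        · rw [norm_smul, Real.norm_eq_abs, abs_of_pos (by norm_num)]; linarith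
        · exact ht1 c hc
      · intro c hc d hd hcd
        rcases Finset.mem_insert.1 hc with rfl | hc <;> rcases Finset.mem_insert.1 hd with rfl | hd
        · exact absurd rfl hcd
        · exact (hsep d hd).le
        · rw [norm_sub_rev]; exact (hsep c hc).le
        · exact ht2 c hc d hd hcd
    have := Nat.le_findGreatest (hbound _ hbig) hbig
    omega

/-- A bound of a bilinear form on `1/2`-nets bounds the operator norm. -/
theorem opNorm_le_of_half_nets {E F : Type*} [NormedAddCommGroup E] [InnerProductSpace ℝ E]
    [NormedAddCommGroup F] [InnerProductSpace ℝ F] (X : E →L[ℝ] F) {s : Finset E} {t : Finset F}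
    (hs : ∀ x : E, ‖x‖ ≤ 1 → ∃ y ∈ s, ‖x - y‖ ≤ 1 / 2)
    (ht : ∀ x : F, ‖x‖ ≤ 1 → ∃ y ∈ t, ‖x - y‖ ≤ 1 / 2) {b : ℝ} (hb : 0 ≤ b)
    (h : ∀ x ∈ s, ∀ y ∈ t, ⟪y, X x⟫ ≤ b) : ‖X‖ ≤ 4 * b := by
  -- Each net costs a factor `2`, by absorbing half of the quantity being bounded.
  have h1 : ∀ x ∈ s, ‖X x‖ ≤ 2 * b := by
    intro x hx
    by_cases h0 : X x = 0
    · rw [h0, norm_zero]; positivity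
    have hpos : 0 < ‖X x‖ := norm_pos_iff.2 h0
    obtain ⟨y, hy, hxy⟩ := ht (‖X x‖⁻¹ • X x)
      (by rw [norm_smul, norm_inv, norm_norm, inv_mul_cancel₀ hpos.ne'])
    have e1 : ⟪‖X x‖⁻¹ • X x, X x⟫ = ‖X x‖ := by
      rw [real_inner_smul_left, real_inner_self_eq_norm_sq]; field_simp
    have e2 : ⟪‖X x‖⁻¹ • X x, X x⟫ = ⟪y, X x⟫ + ⟪‖X x‖⁻¹ • X x - y, X x⟫ := by
      rw [inner_sub_left]; ring
    have e3 := real_inner_le_norm (‖X x‖⁻¹ • X x - y) (X x)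
    have e4 := h x hx y hy
    nlinarith
  have h2 : ‖X‖ ≤ 2 * b + ‖X‖ / 2 := by
    refine ContinuousLinearMap.opNorm_le_of_unit_norm (by positivity) fun x hx => ?_
    obtain ⟨y, hy, hxy⟩ := hs x hx.le
    have e1 : X x = X y + X (x - y) := by simp
    have e2 := X.le_opNorm (x - y)
    have e3 := h1 y hy
    have e4 := norm_add_le (X y) (X (x - y))
    rw [← e1] at e4
    nlinarith [norm_nonneg X]
  linarith

end Net

/-! ### Sub-Gaussian tails of bilinear forms. -/

section Tail

open Real

theorem ProbabilityTheory.HasSubgaussianMGF.mono {Ω : Type*} {mΩ : MeasurableSpace Ω}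
    {μ : Measure Ω} {X : Ω → ℝ} {c d : NNReal} (h : HasSubgaussianMGF X c μ) (hcd : c ≤ d) :
    HasSubgaussianMGF X d μ where
  integrable_exp_mul := h.integrable_exp_mul
  mgf_le t := (h.mgf_le t).trans (by gcongr)

namespace SubmatrixLocalization

variable {Ω : Type*} [MeasurableSpace Ω] {μ : Measure Ω} {m n : ℕ} {c₀ σ : ℝ}
  {Z : Ω → Matrix (Fin m) (Fin n) ℝ}

/-- The transposed noise is noise. -/
theorem IsSubGaussianNoise.transpose (h : IsSubGaussianNoise μ c₀ σ Z) :
    IsSubGaussianNoise μ c₀ σ (fun ω => (Z ω)ᵀ) where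
  aemeasurable i j := h.aemeasurable j i
  indep := h.indep.precomp (g := fun p : Fin n × Fin m => (p.2, p.1)) Prod.swap_injective
  identDistrib i j i' j' := h.identDistrib j i j' i'
  mean_zero i j := h.mean_zero j i
  subGaussian i j := h.subGaussian j i

/-- A bilinear form of the noise at vectors of norm at most one is sub-Gaussian. -/
theorem IsSubGaussianNoise.hasSubgaussianMGF_bilin (h : IsSubGaussianNoise μ c₀ σ Z)
    {y : Fin m → ℝ} {x : Fin n → ℝ} (hy : ∑ i, y i ^ 2 ≤ 1) (hx : ∑ j, x j ^ 2 ≤ 1) :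
    HasSubgaussianMGF (fun ω => ∑ i, ∑ j, y i * x j * Z ω i j) (σ ^ 2 / c₀).toNNReal μ := by
  have hi : iIndepFun (fun (p : Fin m × Fin n) ω => y p.1 * x p.2 * Z ω p.1 p.2) μ :=
    h.indep.comp (fun p t => y p.1 * x p.2 * t) (fun p => by fun_prop)
  have h1 := HasSubgaussianMGF.sum_of_iIndepFun hi (s := Finset.univ)
    fun p _ => (h.subGaussian p.1 p.2).const_mul (y p.1 * x p.2)
  simp only [Fintype.sum_prod_type] at h1
  refine h1.mono ?_
  rw [← NNReal.coe_le_coe]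
  push_cast
  have h2 : ∑ i, ∑ j, (y i * x j) ^ 2 * ((σ ^ 2 / c₀).toNNReal : ℝ) =
      (∑ i, y i ^ 2) * (∑ j, x j ^ 2) * ((σ ^ 2 / c₀).toNNReal : ℝ) := by
    simp_rw [Finset.sum_mul_sum, Finset.sum_mul, mul_pow]
  refine (le_of_eq h2).trans ?_
  have h3 : (∑ i, y i ^ 2) * (∑ j, x j ^ 2) ≤ 1 := mul_le_one₀ hy (by positivity) hx
  nlinarith [NNReal.coe_nonneg (σ ^ 2 / c₀).toNNReal]

theorem IsSubGaussianNoise.measure_bilin_ge_le [IsProbabilityMeasure μ]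
    (h : IsSubGaussianNoise μ c₀ σ Z) (hc₀ : 0 < c₀)
    {y : Fin m → ℝ} {x : Fin n → ℝ} (hy : ∑ i, y i ^ 2 ≤ 1) (hx : ∑ j, x j ^ 2 ≤ 1)
    {b : ℝ} (hb : 0 ≤ b) :
    μ {ω | b ≤ ∑ i, ∑ j, y i * x j * Z ω i j} ≤
      ENNReal.ofReal (exp (-b ^ 2 / (2 * (σ ^ 2 / c₀)))) := by
  have h1 := (h.hasSubgaussianMGF_bilin hy hx).measure_ge_le hb
  rw [Real.coe_toNNReal _ (by positivity)] at h1
  rw [← ENNReal.ofReal_toReal (measure_ne_top μ _)]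
  exact ENNReal.ofReal_le_ofReal h1

end SubmatrixLocalization

end Tail

/-! ### Matrices as Euclidean operators, and deterministic recovery. -/

namespace SubmatrixLocalization

open scoped RealInnerProductSpace

variable {m n : ℕ}

/-- A matrix as an operator between Euclidean spaces. -/
noncomputable def euclideanOp (A : Matrix (Fin m) (Fin n) ℝ) :
    EuclideanSpace ℝ (Fin n) →L[ℝ] EuclideanSpace ℝ (Fin m) :=
  (Matrix.toEuclideanLin.trans LinearMap.toContinuousLinearMap) A

theorem euclideanOp_apply (A : Matrix (Fin m) (Fin n) ℝ) (x : EuclideanSpace ℝ (Fin n)) :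
    euclideanOp A x = WithLp.toLp 2 (A *ᵥ x.ofLp) := rfl

theorem euclideanOp_add (A B : Matrix (Fin m) (Fin n) ℝ) :
    euclideanOp (A + B) = euclideanOp A + euclideanOp B :=
  ContinuousLinearMap.ext fun x => by
    simp only [euclideanOp_apply, add_apply, Matrix.add_mulVec, WithLp.toLp_add]

theorem continuous_euclideanOp_of :
    Continuous fun w : Fin m → Fin n → ℝ => euclideanOp (Matrix.of w) := by
  let L : (Fin m → Fin n → ℝ) →ₗ[ℝ] EuclideanSpace ℝ (Fin n) →L[ℝ] EuclideanSpace ℝ (Fin m) :=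
    { toFun := fun w => euclideanOp (Matrix.of w)
      map_add' := fun w w' => euclideanOp_add (Matrix.of w) (Matrix.of w')
      map_smul' := fun c w => ContinuousLinearMap.ext fun x => by
        change WithLp.toLp 2 ((c • Matrix.of w) *ᵥ x.ofLp) = c • WithLp.toLp 2 (Matrix.of w *ᵥ _)
        rw [Matrix.smul_mulVec, WithLp.toLp_smul]
        rfl }
  exact L.continuous_of_finiteDimensional

theorem inner_toLp_euclideanOp (A : Matrix (Fin m) (Fin n) ℝ) (u : Fin m → ℝ) (y : Fin n → ℝ) :
    ⟪WithLp.toLp 2 u, euclideanOp A (WithLp.toLp 2 y)⟫ = u ⬝ᵥ A *ᵥ y := by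
  rw [euclideanOp_apply, EuclideanSpace.inner_toLp_toLp, dotProduct_comm]
  simp

open scoped Matrix.Norms.L2Operator in
theorem norm_euclideanOp (A : Matrix (Fin m) (Fin n) ℝ) : ‖euclideanOp A‖ = ‖A‖ := rfl

open scoped Matrix.Norms.L2Operator in
theorem norm_euclideanOp_transpose (A : Matrix (Fin m) (Fin n) ℝ) :
    ‖euclideanOp Aᵀ‖ = ‖euclideanOp A‖ := by
  have := Matrix.l2_opNorm_conjTranspose A
  rwa [Matrix.conjTranspose_eq_transpose_of_trivial] at this

theorem norm_toLp_eq_one_iff {u : Fin m → ℝ} : ‖WithLp.toLp 2 u‖ = 1 ↔ u ⬝ᵥ u = 1 := by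
  have h : u ⬝ᵥ u = ‖WithLp.toLp 2 u‖ ^ 2 := by
    rw [← real_inner_self_eq_norm_sq, EuclideanSpace.inner_toLp_toLp]; simp
  rw [h, pow_eq_one_iff_of_nonneg (norm_nonneg _) two_ne_zero]

/-- Testing the equation for `Aᵀ *ᵥ u` against all vectors `y` replaces the adjoint by inner
products. -/
theorem isTopSingularPair_iff {A : Matrix (Fin m) (Fin n) ℝ} {u : Fin m → ℝ} {v : Fin n → ℝ} :
    IsTopSingularPair A u v ↔
      IsTopPair (euclideanOp A) (WithLp.toLp 2 u) (WithLp.toLp 2 v) := by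
  have key (y : Fin n → ℝ) : ⟪WithLp.toLp 2 v, WithLp.toLp 2 y⟫ = v ⬝ᵥ y := by
    rw [EuclideanSpace.inner_toLp_toLp, dotProduct_comm]; simp
  constructor
  · rintro ⟨h1, h2, h3, h4⟩
    refine ⟨norm_toLp_eq_one_iff.2 h1, norm_toLp_eq_one_iff.2 h2, ?_, fun y => ?_⟩
    · rw [euclideanOp_apply, norm_euclideanOp, h3]; rfl
    · have := inner_toLp_euclideanOp A u y.ofLp
      rw [WithLp.toLp_ofLp] at this
      rw [this, Matrix.dotProduct_mulVec, ← Matrix.mulVec_transpose, h4, smul_dotProduct,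
        ← key, norm_euclideanOp]
      rfl
  · rintro ⟨h1, h2, h3, h4⟩
    refine ⟨norm_toLp_eq_one_iff.1 h1, norm_toLp_eq_one_iff.1 h2, ?_, ?_⟩
    · rw [euclideanOp_apply, norm_euclideanOp] at h3
      exact congrArg WithLp.ofLp h3
    · refine dotProduct_eq _ _ fun y => ?_
      have := h4 (WithLp.toLp 2 y)
      rw [inner_toLp_euclideanOp, key, Matrix.dotProduct_mulVec, ← Matrix.mulVec_transpose,
        norm_euclideanOp] at this
      rw [this, smul_dotProduct, smul_eq_mul]

theorem IsTopSingularPair.transpose {A : Matrix (Fin m) (Fin n) ℝ} {u : Fin m → ℝ}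
    {v : Fin n → ℝ} (h : IsTopSingularPair A u v) : IsTopSingularPair Aᵀ v u := by
  obtain ⟨h1, h2, h3, h4⟩ := h
  have := norm_euclideanOp_transpose A
  rw [norm_euclideanOp, norm_euclideanOp] at this
  refine ⟨h2, h1, ?_, ?_⟩
  · rw [this, h4]
  · rw [this, Matrix.transpose_transpose, h3]

/-- The unit vector along an indicator vector. -/
noncomputable def unitIndicator (S : Finset (Fin m)) : EuclideanSpace ℝ (Fin m) :=
  (√S.card)⁻¹ • WithLp.toLp 2 (indicatorVec S)

theorem norm_unitIndicator {S : Finset (Fin m)} (hS : 1 ≤ S.card) : ‖unitIndicator S‖ = 1 := by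
  have h : ‖WithLp.toLp 2 (indicatorVec S)‖ = √S.card := by
    rw [EuclideanSpace.norm_eq]
    congr 1
    simp [indicatorVec, apply_ite]
  have h0 : 0 < √(S.card : ℝ) := Real.sqrt_pos.2 (by exact_mod_cast hS)
  rw [unitIndicator, norm_smul, h, norm_inv, Real.norm_of_nonneg h0.le, inv_mul_cancel₀ h0.ne']

theorem signal_transpose (lam : ℝ) (R : Finset (Fin m)) (C : Finset (Fin n)) :
    (signal lam R C)ᵀ = signal lam C R := by
  ext i j
  simp [signal, Matrix.vecMulVec_apply, mul_comm]

theorem euclideanOp_signal (lam : ℝ) {R : Finset (Fin m)} {C : Finset (Fin n)}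
    (hR : 1 ≤ R.card) (hC : 1 ≤ C.card) (y : EuclideanSpace ℝ (Fin n)) :
    euclideanOp (signal lam R C) y =
      (lam * (√R.card * √C.card) * ⟪unitIndicator C, y⟫) • unitIndicator R := by
  have h1 : 0 < √(R.card : ℝ) := Real.sqrt_pos.2 (by exact_mod_cast hR)
  have h2 : 0 < √(C.card : ℝ) := Real.sqrt_pos.2 (by exact_mod_cast hC)
  have h3 : ⟪unitIndicator C, y⟫ = (√C.card)⁻¹ * (indicatorVec C ⬝ᵥ y.ofLp) := by
    rw [unitIndicator, real_inner_smul_left]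
    congr 1
    rw [EuclideanSpace.inner_eq_star_dotProduct, dotProduct_comm]
    simp
  rw [euclideanOp_apply, h3, unitIndicator]
  ext i
  simp only [signal, Matrix.smul_mulVec, Matrix.vecMulVec_mulVec, PiLp.smul_apply, smul_eq_mul,
    Pi.smul_apply, MulOpposite.smul_eq_mul_unop, MulOpposite.unop_op]
  field_simp

/-- Leaving out one row does not increase the norm. -/
theorem norm_euclideanOp_updateRow_le (A : Matrix (Fin m) (Fin n) ℝ) (i : Fin m) :
    ‖euclideanOp (A.updateRow i 0)‖ ≤ ‖euclideanOp A‖ := by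
  refine ContinuousLinearMap.opNorm_le_bound _ (norm_nonneg _) fun x => ?_
  refine le_trans ?_ ((euclideanOp A).le_opNorm x)
  rw [EuclideanSpace.norm_eq, EuclideanSpace.norm_eq]
  refine Real.sqrt_le_sqrt (Finset.sum_le_sum fun k _ => ?_)
  simp only [euclideanOp_apply, Matrix.updateRow_mulVec]
  by_cases hk : k = i
  · subst hk; simpa using sq_nonneg _
  · simp [hk]

/-- Apply `A` to its own row: the `i`-th coordinate is the squared norm of that row. -/
theorem norm_row_le (A : Matrix (Fin m) (Fin n) ℝ) (i : Fin m) :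
    ‖WithLp.toLp 2 (A i)‖ ≤ ‖euclideanOp A‖ := by
  set z : EuclideanSpace ℝ (Fin n) := WithLp.toLp 2 (A i) with hz
  have h1 : (euclideanOp A z) i = ‖z‖ ^ 2 := by
    rw [← real_inner_self_eq_norm_sq, EuclideanSpace.inner_eq_star_dotProduct]
    simp [euclideanOp_apply, Matrix.mulVec, hz]
  have h2 := (PiLp.norm_apply_le (euclideanOp A z) i).trans ((euclideanOp A).le_opNorm z)
  rw [h1, Real.norm_of_nonneg (sq_nonneg _), sq] at h2
  rcases (norm_nonneg z).eq_or_lt with h | h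
  · rw [← h]; exact norm_nonneg _
  · exact le_of_mul_le_mul_right h2 h

theorem euclideanOp_sub_updateRow (A : Matrix (Fin m) (Fin n) ℝ) (i : Fin m)
    (y : EuclideanSpace ℝ (Fin n)) :
    (euclideanOp A - euclideanOp (A.updateRow i 0)) y =
      ⟪WithLp.toLp 2 (A i), y⟫ • EuclideanSpace.single i (1 : ℝ) := by
  rw [sub_apply, euclideanOp_apply, euclideanOp_apply]
  ext k
  have h : ⟪WithLp.toLp 2 (A i), y⟫ = A i ⬝ᵥ y.ofLp := by
    rw [EuclideanSpace.inner_eq_star_dotProduct, dotProduct_comm]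
    simp
  rw [h]
  by_cases hk : k = i
  · subst hk; simp [Matrix.updateRow_mulVec, Matrix.mulVec]
  · simp [Matrix.updateRow_mulVec, hk]

/-- If the product of each noise row with the top right singular vector of the matrix without that
noise row is small, then thresholding the row projections recovers the rows. -/
theorem threshold_eq_of_leave_one_out {R : Finset (Fin m)} {C : Finset (Fin n)}
    (hR : 1 ≤ R.card) (hC : 1 ≤ C.card) {lam : ℝ} (hlam : 0 < lam)
    {Z : Matrix (Fin m) (Fin n) ℝ} (hZ : ‖euclideanOp Z‖ ≤ lam * (√R.card * √C.card) / 40)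
    (hloo : ∀ i u v, IsTopPair (euclideanOp (signal lam R C + Z.updateRow i 0)) u v →
      |⟪WithLp.toLp 2 (Z i), v⟫| ≤ lam * √C.card / 40)
    {u : Fin m → ℝ} {v : Fin n → ℝ} (h : IsTopSingularPair (signal lam R C + Z) u v) :
    threshold (fun i => (fun j => (signal lam R C + Z) i j) ⬝ᵥ v) = R := by
  have h1 : 1 ≤ √(R.card : ℝ) := Real.one_le_sqrt.2 (by exact_mod_cast hR)
  have h2 : 1 ≤ √(C.card : ℝ) := Real.one_le_sqrt.2 (by exact_mod_cast hC)
  set θ := lam * (√R.card * √C.card) with hθ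
  have hθ0 : 0 < θ := by positivity
  have hp := norm_unitIndicator hR
  have hq := norm_unitIndicator hC
  have hS := euclideanOp_signal lam hR hC
  rw [← hθ] at hS
  have hρ : θ * (√R.card)⁻¹ = lam * √C.card := by rw [hθ]; field_simp
  have hT : 0 < lam * √C.card := by positivity
  have hin : ∀ i ∈ R, unitIndicator R i = (√R.card)⁻¹ := by
    intro i hi; simp [unitIndicator, indicatorVec, hi]
  have hout : ∀ i ∉ R, unitIndicator R i = 0 := by
    intro i hi; simp [unitIndicator, indicatorVec, hi]
  rw [isTopSingularPair_iff] at h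
  have hXS : ‖euclideanOp (signal lam R C + Z) - euclideanOp (signal lam R C)‖ ≤ θ / 40 := by
    rw [euclideanOp_add, add_sub_cancel_left]; exact hZ
  have hqv := (h.abs_inner_ge hp hq hS hθ0 hXS (by linarith)).1
  have hqv1 : |⟪unitIndicator C, WithLp.toLp 2 v⟫| ≤ 1 := by
    simpa [hq, h.norm_right] using abs_real_inner_le_norm (unitIndicator C) (WithLp.toLp 2 v)
  -- Leave-one-out with `η = θ / 40` and `ρ = 1 / √R.card`, so that `η * ρ = lam * √C.card / 40`;
  -- passing to `v` doubles it.
  have hnoise : ∀ i, |⟪WithLp.toLp 2 (Z i), WithLp.toLp 2 v⟫| ≤ lam * √C.card / 20 := by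
    intro i
    have hneZ : ∃ u' v', IsTopPair (euclideanOp (signal lam R C + Z.updateRow i 0)) u' v' := by
      refine exists_isTopPair _ fun h0 => ?_
      have := sub_le_opNorm_of_rank_one hp hq hS hθ0.le
        (X := euclideanOp (signal lam R C + Z.updateRow i 0)) (η := θ / 40) (by
          rw [euclideanOp_add, add_sub_cancel_left]
          exact (norm_euclideanOp_updateRow_le Z i).trans hZ)
      rw [h0, norm_zero] at this
      linarith
    obtain ⟨u', v', h'⟩ := hneZ
    have := h.abs_inner_le_of_leave_one_out h' hp hq hS hθ0 hXS
      (by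
        rw [euclideanOp_add, add_sub_cancel_left]
        exact (norm_euclideanOp_updateRow_le Z i).trans hZ) (by linarith)
      (e := EuclideanSpace.single i 1) (z := WithLp.toLp 2 (Z i)) (ρ := (√R.card)⁻¹) (by simp)
      (by
        intro y
        rw [euclideanOp_add, euclideanOp_add, add_sub_add_left_eq_sub, euclideanOp_sub_updateRow])
      (by
        intro y
        rw [euclideanOp_add, add_apply, inner_add_right, euclideanOp_apply (Z.updateRow i 0)]
        simp [Matrix.updateRow_mulVec, EuclideanSpace.inner_single_left])
      ((norm_row_le Z i).trans hZ)
      (by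
        simp only [EuclideanSpace.inner_single_left, map_one, one_mul]
        by_cases hi : i ∈ R
        · rw [hin i hi, abs_of_pos (by positivity)]
        · rw [hout i hi, abs_zero]; positivity)
      (inv_le_one_of_one_le₀ h1)
      (by
        refine (hloo i u' v' h').trans (le_of_eq ?_)
        rw [← hρ]; ring)
    refine this.trans (le_of_eq ?_)
    rw [← hρ]; ring
  have ha : ∀ i, (fun j => (signal lam R C + Z) i j) ⬝ᵥ v =
      θ * ⟪unitIndicator C, WithLp.toLp 2 v⟫ * unitIndicator R i +
        ⟪WithLp.toLp 2 (Z i), WithLp.toLp 2 v⟫ := by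
    intro i
    have e1 : (fun j => (signal lam R C + Z) i j) ⬝ᵥ v =
        (euclideanOp (signal lam R C + Z) (WithLp.toLp 2 v)) i := rfl
    rw [e1, euclideanOp_add, add_apply, hS]
    simp only [PiLp.add_apply, PiLp.smul_apply, smul_eq_mul]
    congr 1
    rw [euclideanOp_apply, EuclideanSpace.inner_toLp_toLp, dotProduct_comm]
    simp [Matrix.mulVec]
  set t := ⟪unitIndicator C, WithLp.toLp 2 v⟫ with ht
  have hbig : ∀ i ∈ R, 9 / 10 * (lam * √C.card) ≤ |(fun j => (signal lam R C + Z) i j) ⬝ᵥ v| := by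
    intro i hi
    have e : θ * t * unitIndicator R i = lam * √C.card * t := by
      rw [hin i hi, mul_right_comm, hρ]
    rw [ha i, e]
    have e1 : 19 / 20 * (lam * √C.card) ≤ |lam * √C.card * t| := by
      rw [abs_mul, abs_of_pos hT]; nlinarith
    have e2 := abs_sub_abs_le_abs_sub (lam * √C.card * t)
      (-⟪WithLp.toLp 2 (Z i), WithLp.toLp 2 v⟫)
    rw [abs_neg, sub_neg_eq_add] at e2
    linarith [hnoise i]
  have hle : ∀ i, |(fun j => (signal lam R C + Z) i j) ⬝ᵥ v| ≤ 21 / 20 * (lam * √C.card) := by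
    intro i
    have e1 : |θ * t * unitIndicator R i| ≤ lam * √C.card := by
      by_cases hi : i ∈ R
      · rw [hin i hi, mul_right_comm, hρ, abs_mul, abs_of_pos hT]; nlinarith
      · rw [hout i hi, mul_zero, abs_zero]; exact hT.le
    rw [ha i]
    exact (abs_add_le _ _).trans (by linarith [hnoise i])
  have hsmall : ∀ i ∉ R, |(fun j => (signal lam R C + Z) i j) ⬝ᵥ v| ≤ lam * √C.card / 20 := by
    intro i hi
    rw [ha i, hout i hi, mul_zero, zero_add]
    exact hnoise i
  obtain ⟨l, hl⟩ : R.Nonempty := Finset.card_pos.1 hR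
  ext i
  -- In units of `lam * √C.card`, scores are at least `9 / 10` on `R`, at most `1 / 20` off it and
  -- at most `21 / 20` everywhere, so half the maximum separates the two groups.
  simp only [threshold, Finset.mem_filter, Finset.mem_univ, true_and]
  constructor
  · intro hi
    by_contra hiR
    have e1 := hi l
    have e2 := hbig l hl
    have e3 := hsmall i hiR
    linarith
  · intro hi l
    have e1 := hle l
    have e2 := hbig i hi
    linarith

end SubmatrixLocalization

/-! ### Independence, measurability and probability bounds. -/

/-- If each section of a measurable set has small probability then, by independence, so has the
set. -/
theorem ProbabilityTheory.IndepFun.measure_prodMk_mem_le {Ω α β : Type*} [MeasurableSpace Ω]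
    [MeasurableSpace α] [MeasurableSpace β] {μ : Measure Ω} [IsProbabilityMeasure μ]
    {V : Ω → α} {z : Ω → β} (h : IndepFun V z μ) (hV : AEMeasurable V μ) (hz : AEMeasurable z μ)
    {G : Set (α × β)} (hG : MeasurableSet G) {δ : ENNReal}
    (hδ : ∀ w, μ {ω | (w, z ω) ∈ G} ≤ δ) : μ {ω | (V ω, z ω) ∈ G} ≤ δ := by
  have : IsProbabilityMeasure (μ.map V) := Measure.isProbabilityMeasure_map hV
  have : IsProbabilityMeasure (μ.map z) := Measure.isProbabilityMeasure_map hz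
  have h1 : μ {ω | (V ω, z ω) ∈ G} = μ.map (fun ω => (V ω, z ω)) G :=
    (Measure.map_apply_of_aemeasurable (hV.prodMk hz) hG).symm
  rw [h1, h.map_prod_eq_prod_map_map hV hz, Measure.prod_apply hG]
  calc ∫⁻ w, μ.map z (Prod.mk w ⁻¹' G) ∂(μ.map V) ≤ ∫⁻ _, δ ∂(μ.map V) := by
        refine lintegral_mono fun w => ?_
        rw [Measure.map_apply_of_aemeasurable hz (measurable_prodMk_left hG)]
        exact hδ w
    _ = δ := by simp

namespace SubmatrixLocalization

open scoped RealInnerProductSpace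

variable {m n : ℕ}

/-- The noise matrices `w` and row vectors `z` such that `w` is small and `z` has a large product
with a top right singular vector of the matrix with noise `w`. -/
def largeProjection (S : Matrix (Fin m) (Fin n) ℝ) (η b : ℝ) :
    Set ((Fin m → Fin n → ℝ) × (Fin n → ℝ)) :=
  {x | ∃ u v, IsTopPair (euclideanOp (S + Matrix.of x.1)) u v ∧ ‖euclideanOp (Matrix.of x.1)‖ ≤ η ∧
    b ≤ |⟪WithLp.toLp 2 x.2, v⟫|}

/-- The existential ranges over a compact product of unit spheres, and projecting a closed set along
a compact factor gives a closed set. This supplies measurability for the Fubini argument. -/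
theorem isClosed_largeProjection (S : Matrix (Fin m) (Fin n) ℝ) (η b : ℝ) :
    IsClosed (largeProjection S η b) := by
  let U := Metric.sphere (0 : EuclideanSpace ℝ (Fin m)) 1
  let V := Metric.sphere (0 : EuclideanSpace ℝ (Fin n)) 1
  let G : Set ((U × V) × ((Fin m → Fin n → ℝ) × (Fin n → ℝ))) :=
    {x | IsTopPair (euclideanOp (S + Matrix.of x.2.1)) x.1.1 x.1.2 ∧
      ‖euclideanOp (Matrix.of x.2.1)‖ ≤ η ∧ b ≤ |⟪WithLp.toLp 2 x.2.2, (x.1.2 : _)⟫|}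
  have hW : Continuous fun x : (U × V) × ((Fin m → Fin n → ℝ) × (Fin n → ℝ)) =>
      euclideanOp (Matrix.of x.2.1) := continuous_euclideanOp_of.comp (by fun_prop)
  have hA : Continuous fun x : (U × V) × ((Fin m → Fin n → ℝ) × (Fin n → ℝ)) =>
      euclideanOp (S + Matrix.of x.2.1) := by
    simp only [euclideanOp_add]
    exact continuous_const.add hW
  have hu : Continuous fun x : (U × V) × ((Fin m → Fin n → ℝ) × (Fin n → ℝ)) =>
      (x.1.1 : EuclideanSpace ℝ (Fin m)) := by fun_prop
  have hv : Continuous fun x : (U × V) × ((Fin m → Fin n → ℝ) × (Fin n → ℝ)) =>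
      (x.1.2 : EuclideanSpace ℝ (Fin n)) := by fun_prop
  have hz : Continuous fun x : (U × V) × ((Fin m → Fin n → ℝ) × (Fin n → ℝ)) =>
      WithLp.toLp 2 x.2.2 := by fun_prop
  have hG : IsClosed G := by
    have hG' : G = {x | euclideanOp (S + Matrix.of x.2.1) x.1.2 =
          ‖euclideanOp (S + Matrix.of x.2.1)‖ • (x.1.1 : EuclideanSpace ℝ (Fin m))} ∩
        (⋂ y, {x | ⟪(x.1.1 : EuclideanSpace ℝ (Fin m)), euclideanOp (S + Matrix.of x.2.1) y⟫ =
          ‖euclideanOp (S + Matrix.of x.2.1)‖ * ⟪(x.1.2 : EuclideanSpace ℝ (Fin n)), y⟫}) ∩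
        ({x | ‖euclideanOp (Matrix.of x.2.1)‖ ≤ η} ∩
          {x | b ≤ |⟪WithLp.toLp 2 x.2.2, (x.1.2 : EuclideanSpace ℝ (Fin n))⟫|}) := by
      ext x
      simp only [G, Set.mem_inter_iff, Set.mem_iInter, Set.mem_ofPred_eq]
      refine and_congr_left fun _ => ⟨fun h => ⟨h.map_right, h.inner_left⟩, fun h => ?_⟩
      exact ⟨norm_eq_of_mem_sphere _, norm_eq_of_mem_sphere _, h.1, h.2⟩
    rw [hG']
    refine (IsClosed.inter ?_ (isClosed_iInter fun y => ?_)).inter (IsClosed.inter ?_ ?_)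
    · exact isClosed_eq (hA.clm_apply hv) (hA.norm.smul hu)
    · exact isClosed_eq (hu.inner (hA.clm_apply continuous_const))
        (hA.norm.mul (hv.inner continuous_const))
    · exact isClosed_le hW.norm continuous_const
    · exact isClosed_le continuous_const (hz.inner hv).abs
  have himage : largeProjection S η b = Prod.snd '' G := by
    ext x
    constructor
    · rintro ⟨u, v, h, h1, h2⟩
      exact ⟨((⟨u, by simpa [U] using h.norm_left⟩, ⟨v, by simpa [V] using h.norm_right⟩), x),
        ⟨h, h1, h2⟩, rfl⟩
    · rintro ⟨⟨⟨u, v⟩, x⟩, ⟨h, h1, h2⟩, rfl⟩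
      exact ⟨u, v, h, h1, h2⟩
  rw [himage]
  exact isClosedMap_snd_of_compactSpace G hG

variable {Ω : Type*} [MeasurableSpace Ω] {μ : Measure Ω} {c₀ σ : ℝ}
  {Z : Ω → Matrix (Fin m) (Fin n) ℝ}

/-- A row of the noise is independent of the other rows. -/
theorem IsSubGaussianNoise.indepFun_updateRow [IsProbabilityMeasure μ]
    (h : IsSubGaussianNoise μ c₀ σ Z) (i : Fin m) :
    IndepFun (fun ω => Matrix.of.symm ((Z ω).updateRow i 0)) (fun ω => Z ω i) μ := by
  classical
  let T : Finset (Fin m × Fin n) := Finset.univ.filter fun p => p.1 = i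
  have h1 := h.indep.indepFun_finset₀ Tᶜ T disjoint_compl_left fun p => h.aemeasurable p.1 p.2
  let φ : ((Tᶜ : Finset (Fin m × Fin n)) → ℝ) → Fin m → Fin n → ℝ :=
    fun f k j => if hk : k = i then 0 else f ⟨(k, j), by simp [T, hk]⟩
  let ψ : (T → ℝ) → Fin n → ℝ := fun f j => f ⟨(i, j), by simp [T]⟩
  have hφ : Measurable φ := by
    refine measurable_pi_lambda _ fun k => measurable_pi_lambda _ fun j => ?_
    by_cases hk : k = i
    · simp [φ, hk]
    · simp only [φ, hk, dite_false]
      exact measurable_pi_apply _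
  have hψ : Measurable ψ := measurable_pi_lambda _ fun j => measurable_pi_apply _
  have h2 := h1.comp hφ hψ
  have h3 : (fun ω => Matrix.of.symm ((Z ω).updateRow i 0)) =
      φ ∘ fun ω p => Z ω p.1.1 p.1.2 := by
    ext ω k j
    by_cases hk : k = i
    · subst hk; simp [φ]
    · simp [φ, hk]
  rw [h3]
  exact h2

theorem IsSubGaussianNoise.aemeasurable_updateRow (h : IsSubGaussianNoise μ c₀ σ Z) (i : Fin m) :
    AEMeasurable (fun ω => Matrix.of.symm ((Z ω).updateRow i 0)) μ := by
  refine aemeasurable_pi_lambda _ fun k => aemeasurable_pi_lambda _ fun j => ?_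
  by_cases hk : k = i
  · subst hk; simp
  · simpa [hk] using h.aemeasurable k j

theorem IsSubGaussianNoise.measure_abs_inner_row_ge_le [IsProbabilityMeasure μ]
    (h : IsSubGaussianNoise μ c₀ σ Z)
    (hc₀ : 0 < c₀) (i : Fin m) {v : EuclideanSpace ℝ (Fin n)} (hv : ‖v‖ = 1) {b : ℝ} (hb : 0 ≤ b) :
    μ {ω | b ≤ |⟪WithLp.toLp 2 (Z ω i), v⟫|} ≤
      2 * ENNReal.ofReal (Real.exp (-b ^ 2 / (2 * (σ ^ 2 / c₀)))) := by
  have hv2 : ∑ j, v j ^ 2 = 1 := by rw [← EuclideanSpace.real_norm_sq_eq, hv, one_pow]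
  have hs (s : ℝ) : ∑ k, (Pi.single i s : Fin m → ℝ) k ^ 2 = s ^ 2 := by
    rw [Finset.sum_eq_single i] <;> simp +contextual
  have hform (s : ℝ) (ω : Ω) : ∑ k, ∑ j, (Pi.single i s : Fin m → ℝ) k * v j * Z ω k j =
      s * ⟪WithLp.toLp 2 (Z ω i), v⟫ := by
    rw [Finset.sum_eq_single i]
    · rw [EuclideanSpace.inner_eq_star_dotProduct, dotProduct, Finset.mul_sum]
      refine Finset.sum_congr rfl fun j _ => ?_
      simp; ring
    · intro k _ hk; simp [hk]
    · simp
  have h1 := h.measure_bilin_ge_le hc₀ (y := Pi.single i 1) (x := v)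
    (by rw [hs]; norm_num) hv2.le hb
  have h2 := h.measure_bilin_ge_le hc₀ (y := Pi.single i (-1)) (x := v)
    (by rw [hs]; norm_num) hv2.le hb
  simp only [hform] at h1 h2
  rw [two_mul]
  refine le_trans (measure_mono ?_) ((measure_union_le _ _).trans (add_le_add h1 h2))
  intro ω hω
  have hω' : b ≤ |⟪WithLp.toLp 2 (Z ω i), v⟫| := hω
  rcases le_abs.1 hω' with h | h
  · left; simpa using h
  · right; simpa using h

/-- The leave-one-out tail bound. -/
theorem IsSubGaussianNoise.measure_largeProjection_le [IsProbabilityMeasure μ]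
    (h : IsSubGaussianNoise μ c₀ σ Z)
    (hc₀ : 0 < c₀) {R : Finset (Fin m)} {C : Finset (Fin n)}
    (hR : 1 ≤ R.card) (hC : 1 ≤ C.card) {lam : ℝ} (hlam : 0 < lam) (i : Fin m) {b : ℝ}
    (hb : 0 ≤ b) :
    μ {ω | (Matrix.of.symm ((Z ω).updateRow i 0), Z ω i) ∈
        largeProjection (signal lam R C) (lam * (√R.card * √C.card) / 40) b} ≤
      2 * ENNReal.ofReal (Real.exp (-b ^ 2 / (2 * (σ ^ 2 / c₀)))) := by
  have h1 : 0 < √(R.card : ℝ) := Real.sqrt_pos.2 (by exact_mod_cast hR)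
  have h2 : 0 < √(C.card : ℝ) := Real.sqrt_pos.2 (by exact_mod_cast hC)
  refine (h.indepFun_updateRow i).measure_prodMk_mem_le (h.aemeasurable_updateRow i)
    (aemeasurable_pi_lambda _ fun j => h.aemeasurable i j)
    (isClosed_largeProjection _ _ _).measurableSet fun w => ?_
  -- For fixed `w` of small norm the right vector is unique up to sign, so one fixed `v` describes
  -- the whole section; otherwise the section is empty.
  by_cases hw : ∃ u v, IsTopPair (euclideanOp (signal lam R C + Matrix.of w)) u v ∧
      ‖euclideanOp (Matrix.of w)‖ ≤ lam * (√R.card * √C.card) / 40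
  · obtain ⟨u, v, huv, hn⟩ := hw
    refine le_trans (measure_mono ?_) (h.measure_abs_inner_row_ge_le hc₀ i huv.norm_right hb)
    rintro ω ⟨u', v', h', -, hle⟩
    have := huv.right_unique h' (η := lam * (√R.card * √C.card) / 40) (norm_unitIndicator hR) (norm_unitIndicator hC)
      (euclideanOp_signal lam hR hC) (by positivity)
      (by rw [euclideanOp_add, add_sub_cancel_left]; exact hn) (le_of_eq (by ring))
    rcases this with rfl | rfl
    · exact hle
    · simpa using hle
  · have : {ω | (w, Z ω i) ∈ largeProjection (signal lam R C)
        (lam * (√R.card * √C.card) / 40) b} = ∅ := by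
      refine Set.eq_empty_of_forall_notMem fun ω hω => hw ?_
      obtain ⟨u, v, h, hn, -⟩ := hω
      exact ⟨u, v, h, hn⟩
    rw [this]; simp

/-- The operator norm of the noise is of the order `√(m + n)` up to an exponentially small
probability. -/
theorem IsSubGaussianNoise.measure_norm_gt_le [IsProbabilityMeasure μ]
    (h : IsSubGaussianNoise μ c₀ σ Z)
    (hc₀ : 0 < c₀) (hσ : 0 < σ) {η : ℝ} (hη : 0 ≤ η)
    (hbound : 96 * (σ ^ 2 / c₀) * ((m : ℝ) + n) ≤ η ^ 2) :
    μ {ω | η < ‖euclideanOp (Z ω)‖} ≤ ENNReal.ofReal (Real.exp (-((m : ℝ) + n))) := by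
  obtain ⟨s, hs1, hsc, hsn⟩ := exists_half_net (EuclideanSpace ℝ (Fin n))
  obtain ⟨t, ht1, htc, htn⟩ := exists_half_net (EuclideanSpace ℝ (Fin m))
  rw [finrank_euclideanSpace_fin] at hsc htc
  have hsq {k : ℕ} {x : EuclideanSpace ℝ (Fin k)} (hx : ‖x‖ ≤ 1) : ∑ i, x i ^ 2 ≤ 1 := by
    rw [← EuclideanSpace.real_norm_sq_eq]
    exact pow_le_one₀ (norm_nonneg _) hx
  have hsub : {ω | η < ‖euclideanOp (Z ω)‖} ⊆
      ⋃ p ∈ s ×ˢ t, {ω | η / 4 ≤ ∑ i, ∑ j, p.2 i * p.1 j * Z ω i j} := by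
    intro ω hω
    by_contra hcon
    simp only [Set.mem_iUnion, not_exists, Set.mem_ofPred_eq, not_le, Finset.mem_product] at hcon
    have hle : ‖euclideanOp (Z ω)‖ ≤ 4 * (η / 4) := by
      refine opNorm_le_of_half_nets _ hsn htn (by positivity) fun x hx y hy => ?_
      refine le_trans (le_of_eq ?_) (hcon (x, y) ⟨hx, hy⟩).le
      have := inner_toLp_euclideanOp (Z ω) y.ofLp x.ofLp
      rw [WithLp.toLp_ofLp, WithLp.toLp_ofLp] at this
      rw [this]
      simp only [dotProduct, Matrix.mulVec, Finset.mul_sum]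
      refine Finset.sum_congr rfl fun i _ => Finset.sum_congr rfl fun j _ => by ring
    have : η < ‖euclideanOp (Z ω)‖ := hω
    linarith
  -- At level `η / 4` the exponent is `η ^ 2 / (32 * (σ ^ 2 / c₀)) ≥ 3 * (m + n)`, which beats the
  -- `5 ^ (m + n) ≤ exp (2 * (m + n))` pairs of net points.
  have hterm : ∀ p ∈ s ×ˢ t, μ {ω | η / 4 ≤ ∑ i, ∑ j, p.2 i * p.1 j * Z ω i j} ≤
      ENNReal.ofReal (Real.exp (-3 * ((m : ℝ) + n))) := by
    intro p hp
    rw [Finset.mem_product] at hp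
    refine (h.measure_bilin_ge_le hc₀ (hsq (ht1 _ hp.2)) (hsq (hs1 _ hp.1))
      (by positivity)).trans (ENNReal.ofReal_le_ofReal (Real.exp_le_exp.2 ?_))
    have : 0 < σ ^ 2 / c₀ := by positivity
    rw [div_le_iff₀ (by positivity)]
    nlinarith
  refine (measure_mono hsub).trans ((measure_biUnion_finset_le _ _).trans
    ((Finset.sum_le_card_nsmul _ _ _ hterm).trans ?_))
  rw [nsmul_eq_mul, ← ENNReal.ofReal_natCast, ← ENNReal.ofReal_mul (by positivity)]
  refine ENNReal.ofReal_le_ofReal ?_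
  have hcard : ((s ×ˢ t).card : ℝ) ≤ 5 ^ (m + n) := by
    rw [Finset.card_product, add_comm m n, pow_add]
    exact_mod_cast Nat.mul_le_mul hsc htc
  have he : (5 : ℝ) ≤ Real.exp 2 := by
    have : Real.exp 2 = Real.exp 1 * Real.exp 1 := by rw [← Real.exp_add]; norm_num
    nlinarith [Real.exp_one_gt_d9]
  have h5 : (5 : ℝ) ^ (m + n) ≤ Real.exp (2 * ((m : ℝ) + n)) := by
    calc (5 : ℝ) ^ (m + n) ≤ Real.exp 2 ^ (m + n) := by gcongr
      _ = Real.exp (2 * ((m : ℝ) + n)) := by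
        rw [← Real.exp_nat_mul]; push_cast; ring_nf
  calc ((s ×ˢ t).card : ℝ) * Real.exp (-3 * ((m : ℝ) + n))
      ≤ Real.exp (2 * ((m : ℝ) + n)) * Real.exp (-3 * ((m : ℝ) + n)) := by
        gcongr; exact hcard.trans h5
    _ = Real.exp (-((m : ℝ) + n)) := by rw [← Real.exp_add]; ring_nf

end SubmatrixLocalization

/-! ### Union bounds and the choice of constants. -/

namespace SubmatrixLocalization

open scoped RealInnerProductSpace

variable {m n : ℕ} {Ω : Type*} [MeasurableSpace Ω] {μ : Measure Ω} {c₀ σ : ℝ}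
  {Z : Ω → Matrix (Fin m) (Fin n) ℝ}

/-- Thresholding the row projections recovers the rows with high probability. -/
theorem IsSubGaussianNoise.measure_threshold_ne_le [IsProbabilityMeasure μ]
    (h : IsSubGaussianNoise μ c₀ σ Z) (hc₀ : 0 < c₀) (hσ : 0 < σ) {R : Finset (Fin m)}
    {C : Finset (Fin n)} (hR : 1 ≤ R.card) (hC : 1 ≤ C.card) {lam : ℝ} (hlam : 0 < lam)
    (hm : 2 ≤ m) (hbound : 6 * (σ ^ 2 / c₀) * Real.log m ≤ (lam * √C.card / 40) ^ 2) :
    μ {ω | ‖euclideanOp (Z ω)‖ ≤ lam * (√R.card * √C.card) / 40 ∧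
        ∃ u v, IsTopSingularPair (signal lam R C + Z ω) u v ∧
          threshold (fun i => (fun j => (signal lam R C + Z ω) i j) ⬝ᵥ v) ≠ R} ≤
      ENNReal.ofReal ((m : ℝ) ^ (-1 : ℝ)) := by
  set b := lam * √C.card / 40 with hb
  have hb0 : 0 ≤ b := by positivity
  have hm2 : (2 : ℝ) ≤ m := by exact_mod_cast hm
  have hm0 : (0 : ℝ) < m := by linarith
  refine (measure_mono (t := ⋃ i ∈ Finset.univ,
    {ω | (Matrix.of.symm ((Z ω).updateRow i 0), Z ω i) ∈
        largeProjection (signal lam R C) (lam * (√R.card * √C.card) / 40) b}) ?_).trans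
    ((measure_biUnion_finset_le _ _).trans ((Finset.sum_le_card_nsmul _ _ _
      fun i _ => h.measure_largeProjection_le hc₀ hR hC hlam i hb0).trans ?_))
  · rintro ω ⟨hZ, u, v, huv, hne⟩
    by_contra hcon
    simp only [Set.mem_iUnion, not_exists, Finset.mem_univ, true_and, exists_prop] at hcon
    refine hne (threshold_eq_of_leave_one_out hR hC hlam hZ (fun i u' v' h' => ?_) huv)
    by_contra! hlt
    exact hcon i ⟨u', v', h', (norm_euclideanOp_updateRow_le _ _).trans hZ, hlt.le⟩
  -- Each row fails with probability at most `2 / m ^ 3`; `2 ≤ m` absorbs the `2` in the sum over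
  -- `m` rows.
  · have hexp : Real.exp (-b ^ 2 / (2 * (σ ^ 2 / c₀))) ≤ ((m : ℝ) ^ 3)⁻¹ := by
      rw [← Real.exp_log (by positivity : (0 : ℝ) < ((m : ℝ) ^ 3)⁻¹), Real.log_inv, Real.log_pow]
      refine Real.exp_le_exp.2 ?_
      have : 0 < σ ^ 2 / c₀ := by positivity
      rw [div_le_iff₀ (by positivity)]
      push_cast
      linarith
    have h2 : (2 : ENNReal) = ENNReal.ofReal 2 := by simp
    rw [nsmul_eq_mul, ← ENNReal.ofReal_natCast, h2, ← ENNReal.ofReal_mul (by norm_num),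
      ← ENNReal.ofReal_mul (by positivity), Finset.card_univ, Fintype.card_fin, Real.rpow_neg_one]
    refine ENNReal.ofReal_le_ofReal ?_
    calc (m : ℝ) * (2 * Real.exp (-b ^ 2 / (2 * (σ ^ 2 / c₀))))
        ≤ m * (m * ((m : ℝ) ^ 3)⁻¹) := by gcongr
      _ = (m : ℝ)⁻¹ := by field_simp

/-- If the noise is small and every choice of the top pair gives the right rows and columns, then
the right rows and columns are the only output. -/
theorem spectralOutputs_eq_singleton {R : Finset (Fin m)} {C : Finset (Fin n)}
    (hR : 1 ≤ R.card) (hC : 1 ≤ C.card) {lam : ℝ} (hlam : 0 < lam)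
    {W : Matrix (Fin m) (Fin n) ℝ} (hW : ‖euclideanOp W‖ ≤ lam * (√R.card * √C.card) / 40)
    (hrow : ∀ u v, IsTopSingularPair (signal lam R C + W) u v →
      threshold (fun i => (fun j => (signal lam R C + W) i j) ⬝ᵥ v) = R)
    (hcol : ∀ v u, IsTopSingularPair (signal lam C R + Wᵀ) v u →
      threshold (fun j => (fun i => (signal lam C R + Wᵀ) j i) ⬝ᵥ u) = C) :
    spectralOutputs (signal lam R C + W) = {(R, C)} := by
  have hout : ∀ u v, IsTopSingularPair (signal lam R C + W) u v →
      projectAndThreshold (signal lam R C + W) u v = (R, C) := by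
    intro u v huv
    have h1 := hrow u v huv
    have h2 : IsTopSingularPair (signal lam C R + Wᵀ) v u := by
      rw [← signal_transpose, ← Matrix.transpose_add]; exact huv.transpose
    have h3 := hcol v u h2
    have h4 : (fun j => u ⬝ᵥ fun i => (signal lam R C + W) i j) =
        fun j => (fun i => (signal lam C R + Wᵀ) j i) ⬝ᵥ u := by
      ext j
      rw [← signal_transpose lam R C, ← Matrix.transpose_add, dotProduct_comm]
      rfl
    rw [projectAndThreshold, h1, h4, h3]
  have h1 : 0 < √(R.card : ℝ) := Real.sqrt_pos.2 (by exact_mod_cast hR)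
  have h2 : 0 < √(C.card : ℝ) := Real.sqrt_pos.2 (by exact_mod_cast hC)
  have hθ : 0 < lam * (√R.card * √C.card) := by positivity
  -- Equality with a singleton also needs some output to exist; the matrix is nonzero because its
  -- norm is at least `39 / 40` of the signal's.
  obtain ⟨u, v, huv⟩ := exists_isTopPair (euclideanOp (signal lam R C + W)) fun h0 => by
    have := sub_le_opNorm_of_rank_one (norm_unitIndicator hR) (norm_unitIndicator hC)
      (euclideanOp_signal lam hR hC) hθ.le (X := euclideanOp (signal lam R C + W))
      (η := lam * (√R.card * √C.card) / 40)
      (by rw [euclideanOp_add, add_sub_cancel_left]; exact hW)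
    rw [h0, norm_zero] at this
    linarith
  have huv' : IsTopSingularPair (signal lam R C + W) u.ofLp v.ofLp := isTopSingularPair_iff.2 huv
  ext out
  constructor
  · rintro ⟨u, v, h, rfl⟩
    exact hout u v h
  · rintro rfl
    exact ⟨_, _, huv', (hout _ _ huv').symm⟩

/-- Failure needs large noise norm, or a row or column error under small norm; the column case is
the row case for the transposed noise. -/
theorem IsSubGaussianNoise.measure_spectralOutputs_ne_le [IsProbabilityMeasure μ]
    (h : IsSubGaussianNoise μ c₀ σ Z) (hc₀ : 0 < c₀) (hσ : 0 < σ) {R : Finset (Fin m)}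
    {C : Finset (Fin n)} (hR : 1 ≤ R.card) (hC : 1 ≤ C.card) {lam : ℝ} (hlam : 0 < lam)
    (hm : 2 ≤ m) (hn : 2 ≤ n)
    (hrow : 6 * (σ ^ 2 / c₀) * Real.log m ≤ (lam * √C.card / 40) ^ 2)
    (hcol : 6 * (σ ^ 2 / c₀) * Real.log n ≤ (lam * √R.card / 40) ^ 2)
    (hnorm : 96 * (σ ^ 2 / c₀) * ((m : ℝ) + n) ≤ (lam * (√R.card * √C.card) / 40) ^ 2) :
    μ {ω | ¬ spectralOutputs (signal lam R C + Z ω) = {(R, C)}} ≤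
      ENNReal.ofReal ((m : ℝ) ^ (-1 : ℝ) + (n : ℝ) ^ (-1 : ℝ) + Real.exp (-((m : ℝ) + n))) := by
  have h1 := h.measure_threshold_ne_le hc₀ hσ hR hC hlam hm hrow
  have h2 := h.transpose.measure_threshold_ne_le hc₀ hσ hC hR hlam hn hcol
  have h3 := h.measure_norm_gt_le hc₀ hσ (by positivity) hnorm
  rw [ENNReal.ofReal_add (by positivity) (by positivity),
    ENNReal.ofReal_add (by positivity) (by positivity)]
  refine le_trans (measure_mono ?_) ((measure_union_le _ _).trans
    (add_le_add ((measure_union_le _ _).trans (add_le_add h1 h2)) h3))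
  intro ω hω
  by_contra hcon
  simp only [Set.mem_union, not_or, Set.mem_ofPred_eq, not_and, not_exists, not_lt, not_not] at hcon
  obtain ⟨⟨g1, g2⟩, g3⟩ := hcon
  refine hω (spectralOutputs_eq_singleton hR hC hlam g3 (g1 g3) (g2 ?_))
  rw [norm_euclideanOp_transpose, mul_comm √(C.card : ℝ)]
  exact g3

end SubmatrixLocalization

theorem mainTheorem3 (c₀ : ℝ) (hc₀ : 0 < c₀) :
    ∃ K c : ℝ, 0 < K ∧ 0 < c ∧
      ∀ (m n km kn : ℕ) (R : Finset (Fin m)) (C : Finset (Fin n)),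
        R.card = km → C.card = kn → 1 ≤ km → 1 ≤ kn →
      ∀ (lam σ : ℝ), 0 < σ →
        lam / σ ≥ K * (√(max (m : ℝ) (n : ℝ) / ((km : ℝ) * (kn : ℝ)))
          + √(max (Real.log n / (km : ℝ)) (Real.log m / (kn : ℝ)))) →
      ∀ (Ω : Type*) [MeasurableSpace Ω] (μ : Measure Ω) [IsProbabilityMeasure μ]
        (Z : Ω → Matrix (Fin m) (Fin n) ℝ),
        SubmatrixLocalization.IsSubGaussianNoise μ c₀ σ Z →
        μ {ω | ¬ SubmatrixLocalization.spectralOutputs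
              (SubmatrixLocalization.signal lam R C + Z ω) = {(R, C)}}
          ≤ ENNReal.ofReal ((m : ℝ) ^ (-c) + (n : ℝ) ^ (-c)
              + 2 * Real.exp (-c * ((m : ℝ) + (n : ℝ)))) := by
  -- Squared, the constant gives `1000000 * (σ ^ 2 / c₀)`; the row and column bounds need `6 * 40 ^
  -- 2`, and the norm bound `2 * 96 * 40 ^ 2` since `m + n ≤ 2 * max m n`.
  refine ⟨1000 / √c₀, 1, by positivity, one_pos, ?_⟩
  rintro m n km kn R C rfl rfl hR hC lam σ hσ hsnr Ω _ μ _ Z hZ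
  have hm1 : 1 ≤ m := hR.trans (by simpa using Finset.card_le_univ R)
  have hn1 : 1 ≤ n := hC.trans (by simpa using Finset.card_le_univ C)
  have htriv : ∀ x : ℝ, 1 ≤ x → μ {ω | ¬ SubmatrixLocalization.spectralOutputs
      (SubmatrixLocalization.signal lam R C + Z ω) = {(R, C)}} ≤ ENNReal.ofReal x := by
    intro x hx
    refine prob_le_one.trans ?_
    rw [← ENNReal.ofReal_one]
    exact ENNReal.ofReal_le_ofReal hx
  -- With a single row or column, the claimed bound is at least one.
  rcases hm1.eq_or_lt with rfl | hm
  · refine htriv _ ?_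
    rw [Nat.cast_one, Real.one_rpow, add_assoc, le_add_iff_nonneg_right]
    positivity
  rcases hn1.eq_or_lt with rfl | hn
  · refine htriv _ ?_
    rw [Nat.cast_one, Real.one_rpow, add_right_comm, le_add_iff_nonneg_left]
    positivity
  have hkm : (0 : ℝ) < R.card := by exact_mod_cast hR
  have hkn : (0 : ℝ) < C.card := by exact_mod_cast hC
  have hm0 : (0 : ℝ) < m := by exact_mod_cast hm1
  have hK : 0 < 1000 / √c₀ := by positivity
  set N : ℝ := max (m : ℝ) n with hN
  have hN0 : 0 < N := lt_max_of_lt_left hm0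
  set Q : ℝ := max (Real.log n / R.card) (Real.log m / C.card) with hQ
  have hs1 : 1000 / √c₀ * √(N / (R.card * C.card)) ≤ lam / σ :=
    le_trans (by gcongr; exact le_add_of_nonneg_right (Real.sqrt_nonneg _)) hsnr
  have hs2 : 1000 / √c₀ * √Q ≤ lam / σ :=
    le_trans (by gcongr; exact le_add_of_nonneg_left (Real.sqrt_nonneg _)) hsnr
  have hlam : 0 < lam := by
    have : 0 < lam / σ := lt_of_lt_of_le (by positivity) hs1
    exact (div_pos_iff_of_pos_right hσ).1 this
  have hsq : ∀ q : ℝ, 0 ≤ q → 1000 / √c₀ * √q ≤ lam / σ →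
      1000000 * (σ ^ 2 / c₀) * q ≤ lam ^ 2 := by
    intro q hq hle
    have h1 : (1000 / √c₀ * √q) ^ 2 ≤ (lam / σ) ^ 2 := by gcongr
    rw [mul_pow, div_pow, div_pow, Real.sq_sqrt hc₀.le, Real.sq_sqrt hq,
      le_div_iff₀ (by positivity)] at h1
    refine le_trans (le_of_eq ?_) h1
    ring
  have hτ : 0 < σ ^ 2 / c₀ := by positivity
  have hlogm : 0 ≤ Real.log m := Real.log_natCast_nonneg m
  have hlogn : 0 ≤ Real.log n := Real.log_natCast_nonneg n
  have hQ0 : 0 ≤ Q := le_max_of_le_left (by positivity)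
  have hq1 := hsq _ (by positivity) hs1
  have hq2 := hsq _ hQ0 hs2
  refine (hZ.measure_spectralOutputs_ne_le hc₀ hσ hR hC hlam hm hn ?_ ?_ ?_).trans
    (ENNReal.ofReal_le_ofReal ?_)
  · have h1 : 1000000 * (σ ^ 2 / c₀) * (Real.log m / C.card) ≤ lam ^ 2 :=
      le_trans (by gcongr; exact le_max_right _ _) hq2
    rw [← mul_div_assoc, div_le_iff₀ hkn] at h1
    rw [div_pow, mul_pow, Real.sq_sqrt hkn.le]
    nlinarith [mul_nonneg hτ.le hlogm]
  · have h1 : 1000000 * (σ ^ 2 / c₀) * (Real.log n / R.card) ≤ lam ^ 2 :=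
      le_trans (by gcongr; exact le_max_left _ _) hq2
    rw [← mul_div_assoc, div_le_iff₀ hkm] at h1
    rw [div_pow, mul_pow, Real.sq_sqrt hkm.le]
    nlinarith [mul_nonneg hτ.le hlogn]
  · rw [← mul_div_assoc, div_le_iff₀ (by positivity)] at hq1
    rw [div_pow, mul_pow, mul_pow, Real.sq_sqrt hkn.le, Real.sq_sqrt hkm.le]
    have h2 : (m : ℝ) + n ≤ 2 * N := by
      linarith [le_max_left (m : ℝ) n, le_max_right (m : ℝ) n]
    nlinarith [mul_le_mul_of_nonneg_left h2 hτ.le, mul_nonneg hτ.le hN0.le]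
  · rw [neg_one_mul]
    linarith [Real.exp_nonneg (-((m : ℝ) + n))]
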